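/- Work in ZFC. For a cardinal $\lambda$ let $\lambda^+$ denote its cardinal successor, and identify each cardinal with the corresponding initial ordinal where it is used as an ordinal; for an ordinal $\delta$ let $|\delta|$ be its cardinality and $\operatorname{cof}\delta$ its cofinality. All exponentiation is cardinal exponentiation. (1) If $2^{\aleph_0}<\aleph_\omega$, then $\aleph_\omega^{\aleph_0}<\aleph_{(2^{\aleph_0})^+}$. (2) More generally, for every (nonzero) limit ordinal $\delta$, the index of $\aleph_\delta^{\operatorname{cof}\delta}$, i.e. the unique ordinal $\gamma$ with $\aleph_\delta^{\operatorname{cof}\delta}=\aleph_\gamma$, satisfies $\gamma<(|\delta|^{\operatorname{cof}\delta})^+$. -/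

import Mathlib

open scoped Cardinal Ordinal

universe u

/-! Put κ = cof δ and θ = |δ|^κ, so that θ^κ = θ. If ℵ_δ ≤ θ, then ℵ_δ^κ ≤ θ and the index has size
at most θ. Otherwise the argument is pcf theory in the style of Shelah, organised around the
cofinality of ∏_{i ∈ A} b i under everywhere domination (`dominatingNumber`), for κ-sequences b of
ordinals of cofinality above θ.

Two facts carry it. Large products exist (`mk_arrow_le_of_hasDominatingFamily`): if ν ≥ θ functions
always dominate a κ-indexed product of ordinals ω_x, x ≤ δ, of cofinality above θ, then ℵ_δ^κ ≤ ν.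
The values of a function κ → ω_δ are reached from ω_δ by finite descents governed by the
characteristic function of a model of size θ, and scales leave only ν such characteristic functions
on each κ-sequence. There are no gaps (`exists_dominatingNumber_eq_succ`): if a product is not
dominated by ν functions, an exact upper bound of an increasing sequence of length ν⁺ yields a
product whose dominating number, on some A, is exactly ν⁺. Both facts rest on the directedness of ∏
b modulo the sets of small dominating number (`exists_bound_domFilter_succ`).

Hence for δ ≤ ε < γ the cardinal ℵ_{ε+1} is the dominating number of some pair (b, A). There are at
most θ such pairs, so |γ| ≤ θ. Part (1) is the case δ = ω, as ℵ₀^ℵ₀ = 2^ℵ₀. -/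

/-! ### Closure under operations and exact upper bounds -/

/-- A set of ordinals of size at most `θ = θ ^ #ι` closed under `θ` many `ι`-ary operations. -/
theorem exists_range_closed_under {ι K X : Type u} {θ : Cardinal.{u}} (hθ : ℵ₀ ≤ θ)
    (hι : θ ^ #ι = θ) (hK : #K ≤ θ) (hX : #X ≤ θ)
    (op : K → (ι → Ordinal.{u}) → Ordinal.{u}) (x : X → Ordinal.{u}) :
    ∃ (W : Type u) (e : W → Ordinal.{u}), #W ≤ θ ∧ (∀ i, x i ∈ Set.range e) ∧
      ∀ k p, (∀ i, p i ∈ Set.range e) → op k p ∈ Set.range e := by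
  -- Formal terms: well-founded trees with leaves from X and ι-branching nodes from K. The equation
  -- θ ^ #ι = θ bounds their number by θ.
  let β : X ⊕ K → Type u := fun s => Sum.elim (fun _ => PEmpty) (fun _ => ι) s
  let ev : (Σ a, β a → Ordinal.{u}) → Ordinal.{u} := fun s =>
    match s with
    | ⟨Sum.inl i, _⟩ => x i
    | ⟨Sum.inr k, p⟩ => op k p
  refine ⟨WType β, WType.elim Ordinal.{u} ev, ?_, ?_, ?_⟩
  · refine WType.cardinalMk_le_of_le ?_
    have h1 : ∀ a : X ⊕ K, θ ^ #(β a) ≤ θ := by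
      rintro (i | k)
      · simpa [β] using Cardinal.one_le_aleph0.trans hθ
      · exact hι.le
    calc (Cardinal.sum fun a => θ ^ #(β a)) ≤ Cardinal.sum fun _ : X ⊕ K => θ :=
          Cardinal.sum_le_sum _ _ h1
      _ = #(X ⊕ K) * θ := by simp
      _ ≤ θ * θ := by
          gcongr
          rw [Cardinal.mk_sum, Cardinal.lift_id, Cardinal.lift_id]
          exact (add_le_add hX hK).trans (Cardinal.add_eq_self hθ).le
      _ = θ := Cardinal.mul_eq_self hθ
  · intro i
    exact ⟨⟨Sum.inl i, PEmpty.elim⟩, rfl⟩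
  · intro k p hp
    choose w hw using hp
    refine ⟨⟨Sum.inr k, w⟩, ?_⟩
    change op k (fun i => WType.elim Ordinal.{u} ev (w i)) = op k p
    congr 1
    exact funext hw

/-- A colouring of a `θ`-directed order with at most `θ` colours has a cofinal colour. -/
theorem exists_cofinal_fiber {L T : Type u} [Preorder L] {θ : Cardinal.{u}}
    (hL : ∀ (S : Type u) (g : S → L), #S ≤ θ → ∃ l, ∀ s, g s ≤ l)
    (hT : #T ≤ θ) (c : L → T) : ∃ t, ∀ l, ∃ l', l ≤ l' ∧ c l' = t := by
  by_contra! h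
  choose g hg using h
  obtain ⟨l, hl⟩ := hL T g hT
  exact hg (c l) l (hl _) rfl

/-- Exact upper bounds: a family which increases modulo a filter along a `2 ^ #ι`-directed order
has an upper bound below which it is cofinal. -/
theorem exists_exact_upper_bound {ι L : Type u} [Preorder L] {θ : Cardinal.{u}} (hθ : ℵ₀ ≤ θ)
    (hι : θ ^ #ι = θ)
    (hL : ∀ (S : Type u) (g : S → L), #S ≤ θ → ∃ l, ∀ s, g s ≤ l)
    (F : Filter ι) (f : L → ι → Ordinal.{u}) (hf : ∀ l l', l ≤ l' → ∀ᶠ i in F, f l i ≤ f l' i)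
    (b : ι → Ordinal.{u}) (hb : ∀ l i, f l i ≤ b i) :
    ∃ G : ι → Ordinal.{u}, (∀ i, G i ≤ b i) ∧ (∀ l, ∀ᶠ i in F, f l i ≤ G i) ∧
      ∀ h : ι → Ordinal.{u}, ∃ l, ∀ᶠ i in F, h i < G i → h i ≤ f l i := by
  classical
  have hset : #(Set ι) ≤ θ := by
    rw [Cardinal.mk_set, ← hι]
    exact Cardinal.power_le_power_right ((Cardinal.natCast_lt_aleph0 (n := 2)).le.trans hθ)
  have hcard : #ι ≤ θ := (Cardinal.cantor #ι).le.trans (by rwa [← Cardinal.mk_set])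
  obtain ⟨l₁, -⟩ := hL PEmpty PEmpty.elim (by simp)
  by_contra! hno
  let UB : (ι → Ordinal.{u}) → Prop := fun G => (∀ i, G i ≤ b i) ∧ ∀ l, ∀ᶠ i in F, f l i ≤ G i
  have hno' : ∀ G : ι → Ordinal.{u}, ∃ h : ι → Ordinal.{u},
      UB G → ∀ l, ∃ᶠ i in F, h i < G i ∧ f l i < h i := by
    intro G
    by_cases hG : UB G
    · obtain ⟨h, hh⟩ := hno G hG.1 hG.2
      exact ⟨h, fun _ l => (hh l).mono fun i hi => hi⟩
    · exact ⟨G, fun h => (hG h).elim⟩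
  choose w hw using hno'
  -- Close the values of b under the map sending a candidate bound to its counterexample. Having b i
  -- in the set ensures that each f l i has a least majorant there, and that it is at most b i.
  obtain ⟨W, e, hW, hbase, hcl⟩ := exists_range_closed_under (ι := ι) (K := ι) (X := ι) hθ hι
    hcard hcard (fun i p => w p i) b
  have hex : ∀ l i, ∃ v : W, f l i ≤ e v ∧ e v ≤ b i ∧ ∀ v', f l i ≤ e v' → e v ≤ e v' := by
    intro l i
    obtain ⟨v₀, hv₀⟩ := hbase i
    have hne : {o | o ∈ Set.range e ∧ f l i ≤ o}.Nonempty := ⟨e v₀, ⟨v₀, rfl⟩, hv₀ ▸ hb l i⟩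
    obtain ⟨⟨v, hv⟩, hle⟩ := csInf_mem hne
    refine ⟨v, hv ▸ hle, ?_, fun v' hv' => ?_⟩
    · rw [hv, ← hv₀]
      exact csInf_le' ⟨⟨v₀, rfl⟩, hv₀ ▸ hb l i⟩
    · rw [hv]
      exact csInf_le' ⟨⟨v', rfl⟩, hv'⟩
  choose v hv1 hv2 hv3 using hex
  have hWι : #(ι → W) ≤ θ := by
    rw [← Cardinal.power_def, ← hι]
    exact Cardinal.power_le_power_right hW
  obtain ⟨t, ht⟩ := exists_cofinal_fiber hL hWι v
  have hUB : UB fun i => e (t i) := by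
    refine ⟨fun i => ?_, fun l => ?_⟩
    · obtain ⟨l', -, hl'⟩ := ht l₁
      rw [← hl']
      exact hv2 l' i
    · obtain ⟨l', hll', hl'⟩ := ht l
      filter_upwards [hf l l' hll'] with i hi
      rw [← hl']
      exact hi.trans (hv1 l' i)
  set G : ι → Ordinal.{u} := fun i => e (t i) with hG
  have hwG := hw G hUB
  -- The set where `w G` refutes G is the same A for cofinally many l. So lowering G to `w G` on A
  -- still gives an upper bound modulo F, with values in the closed set; this contradicts the choice
  -- of G i as least majorant of f l' i.
  obtain ⟨A, hA⟩ := exists_cofinal_fiber hL hset (fun l => {i | w G i < G i ∧ f l i < w G i})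
  obtain ⟨l₀, hl₀⟩ : ∃ l, {i | w G i < G i ∧ f l i < w G i} = A := by
    obtain ⟨l', -, hl'⟩ := hA l₁
    exact ⟨l', hl'⟩
  have hApos : ∃ᶠ i in F, i ∈ A := by
    rw [← hl₀]; exact hwG l₀
  have hG'mem : ∀ i, ∃ x : W, e x = if i ∈ A then w G i else G i := by
    intro i
    by_cases hi : i ∈ A
    · simpa [hi] using hcl i G fun j => ⟨t j, rfl⟩
    · exact ⟨t i, by simp [hi, hG]⟩
  have hbound : ∀ l, ∀ᶠ i in F, f l i ≤ if i ∈ A then w G i else G i := by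
    intro l
    obtain ⟨l', hll', hl'⟩ := hA l
    filter_upwards [hf l l' hll', hUB.2 l] with i hi hi2
    by_cases hiA : i ∈ A
    · simp only [hiA, if_true]
      rw [← hl'] at hiA
      exact hi.trans hiA.2.le
    · simpa [hiA] using hi2
  obtain ⟨l', -, hl'⟩ := ht l₀
  obtain ⟨i, hiA, hi⟩ := (hApos.and_eventually (hbound l')).exists
  obtain ⟨x, hx⟩ := hG'mem i
  rw [← hx] at hi
  have h1 := hv3 l' i x hi
  rw [hl', hx, if_pos hiA] at h1
  rw [← hl₀] at hiA
  exact absurd h1 (not_le.2 hiA.1)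

/-! ### Cofinal maps, dominating families and their ideals -/

/-- A cofinal strictly increasing enumeration of each ordinal by its cofinality. -/
theorem exists_cofinal_map (o : Ordinal.{u}) : ∃ C : Ordinal.{u} → Ordinal.{u},
    (∀ x < o.cof.ord, C x < o) ∧ (∀ x y, x < y → y < o.cof.ord → C x < C y) ∧
      ∀ y < o, ∃ x < o.cof.ord, y ≤ C x := by
  classical
  obtain ⟨f, hf⟩ := Ordinal.exists_isFundamentalSeq (o := o) rfl
  refine ⟨fun x => if hx : x < o.cof.ord then f ⟨x, hx⟩ else 0, ?_, ?_, ?_⟩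
  · intro x hx
    simp only [hx, dif_pos]
    exact (f ⟨x, hx⟩).2
  · intro x y hxy hy
    simp only [hy, hxy.trans hy, dif_pos]
    exact hf.strictMono (show (⟨x, hxy.trans hy⟩ : Set.Iio o.cof.ord) < ⟨y, hy⟩ from hxy)
  · intro y hy
    obtain ⟨_, ⟨x, rfl⟩, hx⟩ := hf.isCofinal_range ⟨y, hy⟩
    have hx' : (x : Ordinal.{u}) < o.cof.ord := x.2
    refine ⟨x, hx', ?_⟩
    simp only [hx', dif_pos]
    exact hx

/-- `∏ i ∈ A, b i` is dominated by a family of at most `μ` elements of `∏ i, b i`. -/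
def HasDominatingFamily {ι : Type u} (b : ι → Ordinal.{u}) (A : Set ι) (μ : Cardinal.{u}) : Prop :=
  ∃ (T : Type u) (c : T → ι → Ordinal.{u}), #T ≤ μ ∧ (∀ t i, c t i < b i) ∧
    ∀ h : ι → Ordinal.{u}, (∀ i, h i < b i) → ∃ t, ∀ i ∈ A, h i ≤ c t i

namespace HasDominatingFamily

variable {ι : Type u} {b : ι → Ordinal.{u}} {A B : Set ι} {μ μ' : Cardinal.{u}}

theorem mono (h : HasDominatingFamily b A μ) (hμ : μ ≤ μ') (hB : B ⊆ A) :
    HasDominatingFamily b B μ' := by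
  obtain ⟨T, c, hT, hc, hd⟩ := h
  refine ⟨T, c, hT.trans hμ, hc, fun g hg => ?_⟩
  obtain ⟨t, ht⟩ := hd g hg
  exact ⟨t, fun i hi => ht i (hB hi)⟩

theorem union (h : HasDominatingFamily b A μ) (h' : HasDominatingFamily b B μ') :
    HasDominatingFamily b (A ∪ B) (μ * μ') := by
  classical
  obtain ⟨T, c, hT, hc, hd⟩ := h
  obtain ⟨T', c', hT', hc', hd'⟩ := h'
  refine ⟨T × T', fun t i => if i ∈ A then c t.1 i else c' t.2 i, ?_, ?_, fun g hg => ?_⟩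
  · rw [Cardinal.mk_prod, Cardinal.lift_id, Cardinal.lift_id]
    exact mul_le_mul' hT hT'
  · intro t i
    dsimp only
    split_ifs
    exacts [hc _ _, hc' _ _]
  · obtain ⟨t, ht⟩ := hd g hg
    obtain ⟨t', ht'⟩ := hd' g hg
    refine ⟨(t, t'), fun i hi => ?_⟩
    by_cases hiA : i ∈ A
    · simpa [hiA] using ht i hiA
    · simpa [hiA] using ht' i (hi.resolve_left hiA)

theorem empty (hb : ∀ i, 0 < b i) : HasDominatingFamily b ∅ 1 :=
  ⟨PUnit, fun _ _ => 0, by simp, fun _ i => hb i, fun _ _ => ⟨⟨⟩, by simp⟩⟩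

theorem exists_card (b : ι → Ordinal.{u}) (A : Set ι) : ∃ μ, HasDominatingFamily b A μ := by
  refine ⟨_, ∀ i, (b i).ToType, fun t i => (Ordinal.ToType.mk.symm (t i) : Set.Iio (b i)), le_rfl,
    fun t i => (Ordinal.ToType.mk.symm (t i)).2, fun h hh => ?_⟩
  exact ⟨fun i => Ordinal.ToType.mk ⟨h i, hh i⟩, fun i _ => by simp⟩

end HasDominatingFamily

/-- The least size of a family dominating `∏ i ∈ A, b i`. -/
noncomputable def dominatingNumber {ι : Type u} (b : ι → Ordinal.{u}) (A : Set ι) : Cardinal.{u} :=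
  sInf {μ | HasDominatingFamily b A μ}

theorem hasDominatingFamily_dominatingNumber {ι : Type u} (b : ι → Ordinal.{u}) (A : Set ι) :
    HasDominatingFamily b A (dominatingNumber b A) :=
  csInf_mem (s := {μ | HasDominatingFamily b A μ}) (HasDominatingFamily.exists_card b A)

theorem dominatingNumber_le {ι : Type u} {b : ι → Ordinal.{u}} {A : Set ι} {μ : Cardinal.{u}}
    (h : HasDominatingFamily b A μ) : dominatingNumber b A ≤ μ :=
  csInf_le' h

/-- The filter dual to the ideal of sets `A` for which `∏ i ∈ A, b i` is dominated by fewer than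
`ν` functions. -/
def domFilter {ι : Type u} (b : ι → Ordinal.{u}) (ν : Cardinal.{u}) (hν : ℵ₀ ≤ ν)
    (hb : ∀ i, 0 < b i) : Filter ι :=
  Filter.comk (fun A => ∃ μ < ν, HasDominatingFamily b A μ)
    ⟨1, Cardinal.one_lt_aleph0.trans_le hν, HasDominatingFamily.empty hb⟩
    (fun _ ⟨μ, hμ, h⟩ _ hs => ⟨μ, hμ, h.mono le_rfl hs⟩)
    (fun _ ⟨μ, hμ, h⟩ _ ⟨μ', hμ', h'⟩ =>
      ⟨μ * μ', Cardinal.mul_lt_of_lt hν hμ hμ', h.union h'⟩)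

theorem mem_domFilter {ι : Type u} {b : ι → Ordinal.{u}} {ν : Cardinal.{u}} {hν : ℵ₀ ≤ ν}
    {hb : ∀ i, 0 < b i} {U : Set ι} :
    U ∈ domFilter b ν hν hb ↔ ∃ μ < ν, HasDominatingFamily b Uᶜ μ :=
  Filter.mem_comk

theorem domFilter_anti {ι : Type u} {b : ι → Ordinal.{u}} {ν ν' : Cardinal.{u}} {hν : ℵ₀ ≤ ν}
    {hν' : ℵ₀ ≤ ν'} {hb : ∀ i, 0 < b i} (h : ν ≤ ν') :
    domFilter b ν' hν' hb ≤ domFilter b ν hν hb := by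
  intro U hU
  obtain ⟨μ, hμ, hd⟩ := mem_domFilter.1 hU
  exact mem_domFilter.2 ⟨μ, hμ.trans_le h, hd⟩

/-! ### Directedness modulo small sets -/

/-- Transfinite construction of strictly increasing sequences modulo a filter. -/
theorem exists_increasing_family {ι L : Type u} [LinearOrder L] [WellFoundedLT L] (F : Filter ι)
    (b : ι → Ordinal.{u}) (hb : ∀ i, Order.IsSuccLimit (b i))
    (H : ∀ l : L, ∀ g : Set.Iio l → ι → Ordinal.{u}, (∀ m i, g m i < b i) →
      ∃ h : ι → Ordinal.{u}, (∀ i, h i < b i) ∧ ∀ m, ∀ᶠ i in F, g m i ≤ h i)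
    (f : L → ι → Ordinal.{u}) (hf : ∀ l i, f l i < b i) :
    ∃ f' : L → ι → Ordinal.{u}, (∀ l i, f' l i < b i) ∧ (∀ l i, f l i ≤ f' l i) ∧
      ∀ m l, m < l → ∀ᶠ i in F, f' m i < f' l i := by
  choose B hB1 hB2 using H
  let P := {h : ι → Ordinal.{u} // ∀ i, h i < b i}
  let step : ∀ l : L, (∀ m, m < l → P) → P := fun l r =>
    ⟨fun i => max (f l i) (Order.succ (B l (fun m => (r m m.2).1) (fun m => (r m m.2).2) i)),
      fun i => max_lt (hf l i) ((hb i).succ_lt (hB1 l _ _ i))⟩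
  let φ : L → P := (wellFounded_lt (α := L)).fix step
  have hφ : ∀ l, φ l = step l fun m _ => φ m := fun l => WellFounded.fix_eq _ _ _
  refine ⟨fun l => (φ l).1, fun l => (φ l).2, fun l i => ?_, fun m l hml => ?_⟩
  · dsimp only
    rw [hφ l]
    exact le_max_left _ _
  · filter_upwards [hB2 l (fun m : Set.Iio l => (φ m).1) (fun m => (φ m).2) ⟨m, hml⟩] with i hi
    rw [hφ l]
    exact lt_max_of_lt_right (Order.lt_succ_of_le hi)

/-- `∏ i, b i` is `ν`-directed modulo the ideal of sets on which it has small dominating number. -/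
theorem exists_bound_domFilter_succ {ι : Type u} {θ ν : Cardinal.{u}} (hθ : ℵ₀ ≤ θ)
    (hι : θ ^ #ι = θ) (hν : θ ≤ ν) (b : ι → Ordinal.{u}) (hb : ∀ i, θ < (b i).cof)
    (hν' : ℵ₀ ≤ Order.succ ν) (hb0 : ∀ i, 0 < b i)
    (T : Type u) (hT : #T ≤ ν) (f : T → ι → Ordinal.{u}) (hf : ∀ t i, f t i < b i) :
    ∃ h : ι → Ordinal.{u}, (∀ i, h i < b i) ∧
      ∀ t, ∀ᶠ i in domFilter b (Order.succ ν) hν' hb0, f t i ≤ h i := by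
  classical
  have hlim : ∀ i, Order.IsSuccLimit (b i) := fun i =>
    Ordinal.one_lt_cof_iff.1 (Cardinal.one_lt_aleph0.trans_le (hθ.trans (hb i).le))
  have hset : #(Set ι) ≤ θ := by
    rw [Cardinal.mk_set, ← hι]
    exact Cardinal.power_le_power_right ((Cardinal.natCast_lt_aleph0 (n := 2)).le.trans hθ)
  -- By induction shorter families are bounded, so the given one may be replaced by an increasing
  -- sequence of length μ.
  induction hμ : #T using WellFoundedLT.induction generalizing T with
  | ind μ ih =>
  set F := domFilter b (Order.succ ν) hν' hb0 with hF
  let L := μ.ord.ToType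
  have hLT : #L = #T := by rw [Cardinal.mk_ord_toType, hμ]
  obtain ⟨eqv⟩ := Cardinal.eq.1 hLT
  obtain ⟨f', hf'b, hff', hinc⟩ := exists_increasing_family (L := L) F b hlim
    (fun l g hg => ih _ ((Cardinal.mk_Iio_lt l (by simp [L])).trans_eq (hLT.trans hμ)) _
      ((Cardinal.mk_set_le _).trans (hLT.trans_le hT)) g hg rfl)
    (fun l => f (eqv l)) (fun l => hf (eqv l))
  have hmono : ∀ l l', l ≤ l' → ∀ᶠ i in F, f' l i ≤ f' l' i := by
    intro l l' hl
    rcases hl.eq_or_lt with rfl | hl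
    · exact Filter.Eventually.of_forall fun _ => le_rfl
    · exact (hinc l l' hl).mono fun _ => le_of_lt
  suffices h : ∃ h : ι → Ordinal.{u}, (∀ i, h i < b i) ∧ ∀ l, ∀ᶠ i in F, f' l i ≤ h i by
    obtain ⟨h, h1, h2⟩ := h
    refine ⟨h, h1, fun t => ?_⟩
    filter_upwards [h2 (eqv.symm t)] with i hi
    have := hff' (eqv.symm t) i
    rw [eqv.apply_symm_apply] at this
    exact this.trans hi
  by_cases hL : ∀ (S : Type u) (g : S → L), #S ≤ θ → ∃ l, ∀ s, g s ≤ l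
  · obtain ⟨G, hGb, hGub, hGex⟩ := exists_exact_upper_bound hθ hι hL F f' hmono b
      fun l i => (hf'b l i).le
    refine ⟨fun i => if G i < b i then G i else 0, fun i => ?_, fun l => ?_⟩
    · dsimp only
      split_ifs with h
      exacts [h, hb0 i]
    -- Where G reaches b, the sequence is cofinal in ∏ b up to a set in the ideal. Patching it with
    -- one dominating family for each such set gives ν functions, so this part of ι is itself in the
    -- ideal.
    have hmem : {i | G i < b i} ∈ F := by
      refine mem_domFilter.2 ⟨ν, Order.lt_succ ν, ?_⟩
      let 𝒳 := {X : Set ι // HasDominatingFamily b X ν}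
      choose T' c hT' hc hd using fun X : 𝒳 => X.2
      refine ⟨L × (Σ X : 𝒳, T' X), fun t i => if i ∈ t.2.1.1 then c t.2.1 t.2.2 i else f' t.1 i,
        ?_, ?_, ?_⟩
      · have h1 : #(Σ X : 𝒳, T' X) ≤ ν := by
          rw [Cardinal.mk_sigma]
          calc (Cardinal.sum fun X : 𝒳 => #(T' X)) ≤ Cardinal.sum fun _ : 𝒳 => ν :=
                Cardinal.sum_le_sum _ _ hT'
            _ = #𝒳 * ν := by simp
            _ ≤ ν * ν := by
                gcongr
                exact (Cardinal.mk_subtype_le _).trans (hset.trans hν)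
            _ = ν := Cardinal.mul_eq_self (hθ.trans hν)
        rw [Cardinal.mk_prod, Cardinal.lift_id, Cardinal.lift_id]
        exact (mul_le_mul' (hLT.trans_le hT) h1).trans (Cardinal.mul_eq_self (hθ.trans hν)).le
      · intro t i
        dsimp only
        split_ifs
        exacts [hc _ _ _, hf'b _ _]
      · intro h hh
        obtain ⟨l, hl⟩ := hGex h
        obtain ⟨μ', hμ', hX⟩ := mem_domFilter.1 hl
        let X : 𝒳 := ⟨_, hX.mono (Order.lt_succ_iff.1 hμ') le_rfl⟩
        obtain ⟨t, ht⟩ := hd X h hh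
        refine ⟨(l, ⟨X, t⟩), fun i hi => ?_⟩
        dsimp only
        split_ifs with hiX
        · exact ht i hiX
        · have h3 : h i < G i → h i ≤ f' l i := by
            by_contra h4
            exact hiX h4
          exact h3 ((hh i).trans_le (not_lt.1 hi))
    filter_upwards [hmem, hGub l] with i hi hi2
    simpa [show G i < b i from hi] using hi2
  -- Here at most θ terms are cofinal in the sequence, and their pointwise supremum stays below b
  -- because every cofinality exceeds θ.
  · push Not at hL
    obtain ⟨S, g, hS, hg⟩ := hL
    refine ⟨fun i => ⨆ s, f' (g s) i, fun i => ?_, fun l => ?_⟩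
    · exact Ordinal.iSup_lt_of_lt_cof (hS.trans_lt (hb i)) fun s => hf'b _ i
    · obtain ⟨s, hs⟩ := hg l
      filter_upwards [hmono l (g s) (le_of_lt hs)] with i hi
      exact hi.trans (Ordinal.le_iSup (fun s => f' (g s) i) s)

/-- Apply the successor case at max(#T, θ) < ν: its ideal is contained in the one for ν, so the
bound persists. This covers limit cardinals ν. -/
theorem exists_bound_domFilter {ι : Type u} {θ ν : Cardinal.{u}} (hθ : ℵ₀ ≤ θ)
    (hι : θ ^ #ι = θ) (hν : θ < ν) (b : ι → Ordinal.{u}) (hb : ∀ i, θ < (b i).cof)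
    (hν' : ℵ₀ ≤ ν) (hb0 : ∀ i, 0 < b i)
    (T : Type u) (hT : #T < ν) (f : T → ι → Ordinal.{u}) (hf : ∀ t i, f t i < b i) :
    ∃ h : ι → Ordinal.{u}, (∀ i, h i < b i) ∧
      ∀ t, ∀ᶠ i in domFilter b ν hν' hb0, f t i ≤ h i := by
  obtain ⟨h, h1, h2⟩ := exists_bound_domFilter_succ hθ hι (le_max_right #T θ) b hb
    ((hθ.trans (le_max_right #T θ)).trans (Order.le_succ _)) hb0 T (le_max_left _ _) f hf
  exact ⟨h, h1, fun t => (h2 t).filter_mono (domFilter_anti (Order.succ_le_of_lt (max_lt hT hν)))⟩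

/-! ### Passing to cofinalities; no gaps among dominating numbers -/

/-- Replacing each `b i` by its cofinality does not change dominating numbers. -/
theorem hasDominatingFamily_cof_iff {ι : Type u} {b : ι → Ordinal.{u}} (hb : ∀ i, ℵ₀ ≤ (b i).cof)
    {A : Set ι} {μ : Cardinal.{u}} :
    HasDominatingFamily (fun i => (b i).cof.ord) A μ ↔ HasDominatingFamily b A μ := by
  have hlim : ∀ i, Order.IsSuccLimit (b i) := fun i =>
    Ordinal.one_lt_cof_iff.1 (Cardinal.one_lt_aleph0.trans_le (hb i))
  choose C hC1 hC2 hC3 using fun i => exists_cofinal_map (b i)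
  have hmono : ∀ i x y, x ≤ y → y < (b i).cof.ord → C i x ≤ C i y := by
    intro i x y hxy hy
    rcases hxy.eq_or_lt with rfl | hxy
    exacts [le_rfl, (hC2 i x y hxy hy).le]
  constructor
  · rintro ⟨T, c, hT, hc, hd⟩
    refine ⟨T, fun t i => C i (c t i), hT, fun t i => hC1 i _ (hc t i), fun h hh => ?_⟩
    choose x hx hx' using fun i => hC3 i (h i) (hh i)
    obtain ⟨t, ht⟩ := hd x hx
    exact ⟨t, fun i hi => (hx' i).trans (hmono i _ _ (ht i hi) (hc t i))⟩
  · rintro ⟨T, c, hT, hc, hd⟩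
    -- The successor gives a strict inequality between values of C i, which is what monotonicity can
    -- reflect back to indices.
    choose x hx hx' using fun t i => hC3 i (Order.succ (c t i)) ((hlim i).succ_lt (hc t i))
    refine ⟨T, x, hT, hx, fun h hh => ?_⟩
    obtain ⟨t, ht⟩ := hd (fun i => C i (h i)) fun i => hC1 i _ (hh i)
    refine ⟨t, fun i hi => ?_⟩
    by_contra hlt
    have h1 := (Order.lt_succ_of_le (ht i hi)).trans_le (hx' t i)
    exact absurd h1 (hC2 i _ _ (not_le.1 hlt) (hh i)).asymm

theorem dominatingNumber_cof {ι : Type u} {b : ι → Ordinal.{u}} (hb : ∀ i, ℵ₀ ≤ (b i).cof)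
    (A : Set ι) : dominatingNumber (fun i => (b i).cof.ord) A = dominatingNumber b A := by
  simp only [dominatingNumber, hasDominatingFamily_cof_iff hb]

/-- Successor cardinals up to the dominating number of a product are dominating numbers of
products of smaller ordinals. -/
theorem exists_dominatingNumber_eq_succ {ι : Type u} {θ ν : Cardinal.{u}} (hθ : ℵ₀ ≤ θ)
    (hι : θ ^ #ι = θ) (hν : θ ≤ ν) (b : ι → Ordinal.{u}) (hb : ∀ i, θ < (b i).cof)
    (hbν : ¬ HasDominatingFamily b Set.univ ν) :
    ∃ (g : ι → Ordinal.{u}) (A : Set ι), (∀ i, g i ≤ b i) ∧ (∀ i, θ < (g i).cof) ∧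
      dominatingNumber g A = Order.succ ν := by
  classical
  have hlim : ∀ b : ι → Ordinal.{u}, (∀ i, θ < (b i).cof) → ∀ i, Order.IsSuccLimit (b i) :=
    fun b hb i => Ordinal.one_lt_cof_iff.1 (Cardinal.one_lt_aleph0.trans_le (hθ.trans (hb i).le))
  have hpos : ∀ b : ι → Ordinal.{u}, (∀ i, θ < (b i).cof) → ∀ i, 0 < b i := fun b hb i =>
    Ordinal.cof_pos.1 (bot_le.trans_lt (hb i))
  have hν0 : ℵ₀ ≤ ν := hθ.trans hν
  have hν1 : ℵ₀ ≤ Order.succ ν := hν0.trans (Order.le_succ ν)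
  set F := domFilter b (Order.succ ν) hν1 (hpos b hb) with hF
  have hFne : ∀ U ∈ F, U.Nonempty := by
    intro U hU
    by_contra hne
    rw [Set.not_nonempty_iff_eq_empty] at hne
    obtain ⟨μ, hμ, h⟩ := mem_domFilter.1 hU
    rw [hne, Set.compl_empty] at h
    exact hbν (h.mono (Order.lt_succ_iff.1 hμ) le_rfl)
  let L := (Order.succ ν).ord.ToType
  have hL : #L = Order.succ ν := Cardinal.mk_ord_toType _
  have hreg := Cardinal.isRegular_succ hν0
  obtain ⟨f, hfb, -, hinc⟩ := exists_increasing_family (L := L) F b (hlim b hb)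
    (fun l g hg => exists_bound_domFilter_succ hθ hι hν b hb hν1 (hpos b hb) _
      (Order.lt_succ_iff.1 ((Cardinal.mk_Iio_lt l (by simp [L])).trans_eq hL)) g hg)
    (fun _ _ => 0) (fun _ => hpos b hb)
  have hmono : ∀ l l', l ≤ l' → ∀ᶠ i in F, f l i ≤ f l' i := by
    intro l l' hl
    rcases hl.eq_or_lt with rfl | hl
    · exact Filter.Eventually.of_forall fun _ => le_rfl
    · exact (hinc l l' hl).mono fun _ => le_of_lt
  have hLdir : ∀ (S : Type u) (g : S → L), #S ≤ ν → ∃ l, ∀ s, g s < l := by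
    intro S g hS
    have h1 : ⨆ s, ((Ordinal.ToType.mk.symm (g s) : Set.Iio _) : Ordinal.{u}) + 1 <
        (Order.succ ν).ord := by
      refine Ordinal.iSup_add_one_lt_of_lt_cof ?_ fun s => (Ordinal.ToType.mk.symm (g s)).2
      rw [hreg.cof_ord]
      exact Order.lt_succ_of_le hS
    refine ⟨Ordinal.ToType.mk ⟨_, h1⟩, fun s => ?_⟩
    rw [← OrderIso.symm_apply_lt, ← Subtype.coe_lt_coe]
    refine (Order.lt_succ _).trans_le ?_
    rw [Order.succ_eq_add_one]
    exact Ordinal.le_iSup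
      (fun s => ((Ordinal.ToType.mk.symm (g s) : Set.Iio _) : Ordinal.{u}) + 1) s
  have hLθ : ∀ (S : Type u) (g : S → L), #S ≤ θ → ∃ l, ∀ s, g s ≤ l := fun S g hS =>
    (hLdir S g (hS.trans hν)).imp fun l hl s => (hl s).le
  have hLsucc : ∀ l : L, ∃ l', l < l' := fun l =>
    (hLdir PUnit (fun _ => l) (by simpa using Cardinal.one_le_aleph0.trans hν0)).imp
      fun l' h => h ⟨⟩
  obtain ⟨G, hGb, hGub, hGex⟩ := exists_exact_upper_bound hθ hι hLθ F f hmono b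
    fun l i => (hfb l i).le
  have hGlt : ∀ l, ∀ᶠ i in F, f l i < G i := by
    intro l
    obtain ⟨l', hl'⟩ := hLsucc l
    filter_upwards [hinc l l' hl', hGub l'] with i h1 h2 using h1.trans_le h2
  have hGex' : ∀ h : ι → Ordinal.{u}, ∃ l, ∀ᶠ i in F, h i < G i → h i < f l i := by
    intro h
    obtain ⟨l, hl⟩ := hGex h
    obtain ⟨l', hl'⟩ := hLsucc l
    refine ⟨l', ?_⟩
    filter_upwards [hl, hinc l l' hl'] with i h1 h2 h3 using (h1 h3).trans_lt h2
  -- Where G i has cofinality at most θ, code f l i by the index of a majorant in a short cofinal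
  -- sequence. Only θ codes exist, so a fixed one recurs cofinally; it describes a function below G
  -- that bounds the sequence, against exactness.
  have hGcof : ∀ᶠ i in F, θ < (G i).cof := by
    choose C hC1 hC2 hC3 using fun i => exists_cofinal_map (G i)
    let Θ := θ.ord.ToType
    have hΘ : #Θ = θ := Cardinal.mk_ord_toType _
    let v : Θ → Ordinal.{u} := fun x => (Ordinal.ToType.mk.symm x : Set.Iio θ.ord)
    have hv : ∀ x < θ.ord, ∃ y : Θ, v y = x := fun x hx => ⟨Ordinal.ToType.mk ⟨x, hx⟩, by simp [v]⟩
    have hex : ∀ l i, ∃ y : Θ, (G i).cof ≤ θ → f l i < G i →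
        v y < (G i).cof.ord ∧ f l i ≤ C i (v y) := by
      intro l i
      by_cases h : (G i).cof ≤ θ ∧ f l i < G i
      · obtain ⟨x, hx, hx'⟩ := hC3 i _ h.2
        obtain ⟨y, rfl⟩ := hv x (hx.trans_le (Cardinal.ord_le_ord.2 h.1))
        exact ⟨y, fun _ _ => ⟨hx, hx'⟩⟩
      · obtain ⟨y, -⟩ := hv 0 (Cardinal.ord_pos.2 (Cardinal.aleph0_pos.trans_le hθ))
        exact ⟨y, fun h1 h2 => (h ⟨h1, h2⟩).elim⟩
    choose y hy using hex
    have hΘι : #(ι → Θ) ≤ θ := by rw [← Cardinal.power_def, hΘ, hι]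
    obtain ⟨t, ht⟩ := exists_cofinal_fiber hLθ hΘι y
    obtain ⟨l, hl⟩ := hGex' fun i => C i (v (t i))
    obtain ⟨l', hll', hl'⟩ := ht l
    filter_upwards [hl, hmono l l' hll', hGlt l'] with i h1 h2 h3
    by_contra hcof
    obtain ⟨h4, h5⟩ := hy l' i (not_lt.1 hcof) h3
    rw [hl'] at h4 h5
    exact absurd ((h5.trans_lt (h1 (hC1 i _ h4))).trans_le h2) (lt_irrefl _)
  let g : ι → Ordinal.{u} := fun i => if θ < (G i).cof then G i else b i
  have hg : ∀ i, θ < (g i).cof := by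
    intro i
    dsimp only [g]
    split_ifs with h
    exacts [h, hb i]
  have hgG : ∀ᶠ i in F, g i = G i := by
    filter_upwards [hGcof] with i hi
    simp [g, hi]
  have hν2 : ℵ₀ ≤ Order.succ (Order.succ ν) := hν1.trans (Order.le_succ _)
  let f' : L → ι → Ordinal.{u} := fun l i => if f l i < g i then f l i else 0
  have hf'g : ∀ l i, f' l i < g i := by
    intro l i
    dsimp only [f']
    split_ifs with h
    exacts [h, hpos g hg i]
  have hf'f : ∀ l, ∀ᶠ i in F, f' l i = f l i := by
    intro l
    filter_upwards [hgG, hGlt l] with i h1 h2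
    simp [f', h1, h2]
  -- Bound the whole sequence one cardinal higher, in ∏ g. By exactness some f l exceeds h almost
  -- everywhere modulo F, yet the set where it does has dominating number at most ν⁺.
  obtain ⟨h, hhg, hh⟩ := exists_bound_domFilter_succ hθ hι (hν.trans (Order.le_succ ν)) g hg hν2
    (hpos g hg) L hL.le f' hf'g
  obtain ⟨l, hl⟩ := hGex' h
  obtain ⟨μ, hμ, hdom⟩ := mem_domFilter.1 (hh l)
  refine ⟨g, {i | f' l i ≤ h i}ᶜ, fun i => ?_, hg, le_antisymm
    (dominatingNumber_le (hdom.mono (Order.lt_succ_iff.1 hμ) le_rfl)) (Order.succ_le_of_lt ?_)⟩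
  · dsimp only [g]
    split_ifs
    exacts [hGb i, le_rfl]
  -- If ν functions sufficed on this set, a single f l' would eventually exceed each of them modulo
  -- F, although one of them dominates it there.
  by_contra hle
  obtain ⟨T, c, hT, hc, hd⟩ := (hasDominatingFamily_dominatingNumber g _).mono (not_lt.1 hle)
    (le_refl {i | f' l i ≤ h i}ᶜ)
  choose m hm using fun t => hGex' (c t)
  obtain ⟨l', hl'⟩ := hLdir T m hT
  obtain ⟨t, ht⟩ := hd (f' l') (hf'g l')
  obtain ⟨i, hi⟩ := hFne _ (hl.and ((hm t).and ((hinc _ _ (hl' t)).and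
    (hgG.and ((hf'f l).and (hf'f l'))))))
  obtain ⟨h1, h2, h3, h4, h5, h6⟩ := hi
  rw [← h4] at h1 h2
  have h7 := h1 (hhg i)
  have h8 := ht i (by
    rw [Set.mem_compl_iff, Set.mem_ofPred_eq, h5]
    exact not_le.2 h7)
  rw [h6] at h8
  exact absurd ((h8.trans_lt (h2 (hc t i))).trans h3) (lt_irrefl _)

/-! ### Scales -/

theorem dominatingNumber_mono {ι : Type u} {b : ι → Ordinal.{u}} {A B : Set ι} (h : A ⊆ B) :
    dominatingNumber b A ≤ dominatingNumber b B :=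
  dominatingNumber_le ((hasDominatingFamily_dominatingNumber b B).mono le_rfl h)

theorem dominatingNumber_union_lt {ι : Type u} {b : ι → Ordinal.{u}} {A B : Set ι}
    {ν : Cardinal.{u}} (hν : ℵ₀ ≤ ν) (hA : dominatingNumber b A < ν)
    (hB : dominatingNumber b B < ν) : dominatingNumber b (A ∪ B) < ν :=
  (dominatingNumber_le ((hasDominatingFamily_dominatingNumber b A).union
    (hasDominatingFamily_dominatingNumber b B))).trans_lt (Cardinal.mul_lt_of_lt hν hA hB)

/-- At most θ functions have a pointwise strict upper bound inside the product, since all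
cofinalities exceed θ. -/
theorem lt_dominatingNumber {ι : Type u} {θ : Cardinal.{u}}
    {b : ι → Ordinal.{u}} (hb : ∀ i, θ < (b i).cof) {A : Set ι} (hA : A.Nonempty) :
    θ < dominatingNumber b A := by
  by_contra hle
  obtain ⟨T, c, hT, hc, hd⟩ := (hasDominatingFamily_dominatingNumber b A).mono (not_lt.1 hle)
    (le_refl A)
  obtain ⟨t, ht⟩ := hd (fun i => ⨆ t, c t i + 1) fun i =>
    Ordinal.iSup_add_one_lt_of_lt_cof (hT.trans_lt (hb i)) fun t => hc t i
  obtain ⟨i, hi⟩ := hA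
  have h1 := (Ordinal.le_iSup (fun t => c t i + 1) t).trans (ht i hi)
  exact absurd (Order.lt_add_one_iff.2 le_rfl) (not_lt.2 h1)

/-- An increasing and dominating sequence, modulo sets of smaller dominating number. -/
structure IsScale {ι : Type u} (b : ι → Ordinal.{u}) (A : Set ι)
    (f : Ordinal.{u} → ι → Ordinal.{u}) : Prop where
  lt : ∀ x < (dominatingNumber b A).ord, ∀ i, f x i < b i
  increasing : ∀ x y, x ≤ y → y < (dominatingNumber b A).ord →
    dominatingNumber b {i ∈ A | f y i < f x i} < dominatingNumber b A
  dominating : ∀ h : ι → Ordinal.{u}, (∀ i, h i < b i) → ∃ x < (dominatingNumber b A).ord,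
    dominatingNumber b {i ∈ A | f x i < h i} < dominatingNumber b A

/-- Enumerate an optimal dominating family along its cardinal λ. Directedness modulo sets of
dominating number below λ lets each term bound all earlier ones while staying above its entry in the
enumeration. -/
theorem exists_isScale {ι : Type u} {θ : Cardinal.{u}} (hθ : ℵ₀ ≤ θ) (hι : θ ^ #ι = θ)
    (b : ι → Ordinal.{u}) (hb : ∀ i, θ < (b i).cof) {A : Set ι} (hA : A.Nonempty) :
    ∃ f, IsScale b A f := by
  classical
  have hlam := lt_dominatingNumber hb hA
  set lam := dominatingNumber b A with hlam'
  have hlam0 : ℵ₀ ≤ lam := hθ.trans hlam.le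
  have hlim : ∀ i, Order.IsSuccLimit (b i) := fun i =>
    Ordinal.one_lt_cof_iff.1 (Cardinal.one_lt_aleph0.trans_le (hθ.trans (hb i).le))
  have hpos : ∀ i, 0 < b i := fun i => Ordinal.cof_pos.1 (bot_le.trans_lt (hb i))
  let L := lam.ord.ToType
  have hL : #L = lam := Cardinal.mk_ord_toType _
  obtain ⟨T, c, hT, hc, hd⟩ := hasDominatingFamily_dominatingNumber b A
  have hTL : Nonempty (T ↪ L) := by
    rw [← Cardinal.le_def, hL]
    exact hT
  obtain ⟨j⟩ := hTL
  have : Nonempty T := (hd (fun _ => 0) hpos).nonempty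
  obtain ⟨f, hfb, hcf, hinc⟩ := exists_increasing_family (L := L) (domFilter b lam hlam0 hpos) b hlim
    (fun l g hg => exists_bound_domFilter hθ hι hlam b hb hlam0 hpos _
      ((Cardinal.mk_Iio_lt l (by simp [L])).trans_eq hL) g hg)
    (fun l => c (Function.invFun j l)) (fun l => hc _)
  let m : ∀ x, x < lam.ord → L := fun x hx => Ordinal.ToType.mk ⟨x, hx⟩
  refine ⟨fun x => if hx : x < lam.ord then f (m x hx) else 0, fun x hx i => ?_,
    fun x y hxy hy => ?_, fun h hh => ?_⟩
  · have hx' : x < lam.ord := hx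
    simp only [hx', dif_pos]
    exact hfb _ i
  · have hy' : y < lam.ord := hy
    simp only [hxy.trans_lt hy', hy', dif_pos]
    rcases hxy.eq_or_lt with rfl | hlt
    · simp only [lt_self_iff_false, and_false, Set.ofPred_false]
      exact (dominatingNumber_le (HasDominatingFamily.empty hpos)).trans_lt
        (Cardinal.one_lt_aleph0.trans_le hlam0)
    · have h1 : m x (hxy.trans_lt hy') < m y hy' := (OrderIso.lt_iff_lt _).2
        (show (⟨x, hxy.trans_lt hy'⟩ : Set.Iio lam.ord) < ⟨y, hy'⟩ from hlt)
      obtain ⟨μ, hμ, hdom⟩ := mem_domFilter.1 (hinc _ _ h1)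
      exact (dominatingNumber_le (hdom.mono le_rfl fun i hi => hi.2.asymm)).trans_lt hμ
  · obtain ⟨t, ht⟩ := hd h hh
    refine ⟨(Ordinal.ToType.mk.symm (j t) : Set.Iio lam.ord),
      (Ordinal.ToType.mk.symm (j t)).2, ?_⟩
    have h1 : ((Ordinal.ToType.mk.symm (j t) : Set.Iio lam.ord) : Ordinal.{u}) < lam.ord :=
      (Ordinal.ToType.mk.symm (j t)).2
    refine (dominatingNumber_le ((HasDominatingFamily.empty hpos).mono le_rfl ?_)).trans_lt
      (Cardinal.one_lt_aleph0.trans_le hlam0)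
    rintro i ⟨hi, hlt⟩
    have h3 : m _ h1 = j t := OrderIso.apply_symm_apply _ _
    simp only [h1, dif_pos] at hlt
    rw [h3] at hlt
    have h2 := hcf (j t) i
    rw [Function.leftInverse_invFun j.injective t] at h2
    exact absurd hlt (not_lt.2 ((ht i hi).trans h2))

/-! ### Characteristic functions and closed models -/

/-- The characteristic function of a set of ordinals. -/
noncomputable def characteristic (N : Set Ordinal.{u}) (μ : Ordinal.{u}) : Ordinal.{u} :=
  sSup (Order.succ '' (N ∩ Set.Iio μ))

/-- Because of the successors in the supremum this holds even if N ∩ μ has a maximum. Equal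
characteristic values thus mean mutual cofinality below μ. -/
theorem lt_characteristic {N : Set Ordinal.{u}} {μ x : Ordinal.{u}} :
    x < characteristic N μ ↔ ∃ y ∈ N, y < μ ∧ x ≤ y := by
  have hbdd : BddAbove (Order.succ '' (N ∩ Set.Iio μ)) := by
    refine ⟨μ, ?_⟩
    rintro _ ⟨y, ⟨-, hy⟩, rfl⟩
    exact Order.succ_le_of_lt hy
  constructor
  · intro h
    obtain ⟨_, ⟨y, ⟨hy, hyμ⟩, rfl⟩, hxy⟩ := exists_lt_of_lt_csSup' h
    exact ⟨y, hy, hyμ, Order.lt_succ_iff.1 hxy⟩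
  · rintro ⟨y, hy, hyμ, hxy⟩
    exact (Order.lt_succ_of_le hxy).trans_le (le_csSup hbdd ⟨y, ⟨hy, hyμ⟩, rfl⟩)

theorem characteristic_le (N : Set Ordinal.{u}) (μ : Ordinal.{u}) : characteristic N μ ≤ μ := by
  by_contra! h
  obtain ⟨y, -, hy, hle⟩ := lt_characteristic.1 h
  exact absurd hy (not_lt.2 hle)

/-- Small sets of ordinals closed under the operations given by the scales `f` and by the cofinal
maps `C`. -/
structure IsClosedModel {ι 𝔸 : Type u} (θ : Cardinal.{u}) (a : 𝔸 → Ordinal.{u})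
    (f : (ι → 𝔸) → Set ι → Ordinal.{u} → ι → Ordinal.{u}) (C : Ordinal.{u} → Ordinal.{u} → Ordinal.{u})
    (N : Set Ordinal.{u}) : Prop where
  zero : 0 ∈ N
  scale : ∀ b A, ∀ x ∈ N, ∀ i, f b A x i ∈ N
  bound : ∀ (b : ι → 𝔸) (A : Set ι) (p : ι → Ordinal.{u}), A.Nonempty → (∀ i, p i ∈ N) →
    (∀ i, p i < a (b i)) → ∃ x ∈ N, x < (dominatingNumber (a ∘ b) A).ord ∧
      dominatingNumber (a ∘ b) {i ∈ A | f b A x i < p i} < dominatingNumber (a ∘ b) A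
  iSup : ∀ p : ι → Ordinal.{u}, (∀ i, p i ∈ N) → ⨆ i, p i ∈ N
  small : ∀ β ∈ N, ∀ x < θ.ord, C β x ∈ N
  map : ∀ β ∈ N, ∀ x ∈ N, C β x ∈ N
  inv : ∀ β ∈ N, ∀ y ∈ N, y < β → ∃ x ∈ N, x < β.cof.ord ∧ y ≤ C β x
  card : ∃ (W : Type u) (e : W → Ordinal.{u}), #W ≤ θ ∧ N = Set.range e

section

variable {ι 𝔸 : Type u} {θ : Cardinal.{u}} {a : 𝔸 → Ordinal.{u}}
  {f : (ι → 𝔸) → Set ι → Ordinal.{u} → ι → Ordinal.{u}} {C : Ordinal.{u} → Ordinal.{u} → Ordinal.{u}}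

/-- A Skolem hull: all closure conditions come from at most θ operations of arity ι. -/
theorem exists_isClosedModel [Infinite ι] (hθ : ℵ₀ ≤ θ) (hι : θ ^ #ι = θ) (h𝔸 : #𝔸 ≤ θ)
    (hf : ∀ b A, A.Nonempty → IsScale (a ∘ b) A (f b A))
    (hC : ∀ o, ∀ y < o, ∃ x < o.cof.ord, y ≤ C o x)
    {X : Type u} (hX : #X ≤ θ) (x : X → Ordinal.{u}) :
    ∃ N, IsClosedModel θ a f C N ∧ ∀ j, x j ∈ N := by
  classical
  have hset : #(Set ι) ≤ θ := by
    rw [Cardinal.mk_set, ← hι]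
    exact Cardinal.power_le_power_right ((Cardinal.natCast_lt_aleph0 (n := 2)).le.trans hθ)
  have hcard : #ι ≤ θ := (Cardinal.cantor #ι).le.trans (by rwa [← Cardinal.mk_set])
  have hB : #(ι → 𝔸) ≤ θ := by
    rw [← Cardinal.power_def, ← hι]
    exact Cardinal.power_le_power_right h𝔸
  -- Unary and binary operations are read off these two coordinates of an ι-ary argument.
  obtain ⟨i₀, i₁, hi⟩ := exists_pair_ne ι
  have hbd : ∀ (b : ι → 𝔸) (A : Set ι) (p : ι → Ordinal.{u}), ∃ x, A.Nonempty →
      (∀ i, p i < a (b i)) → x < (dominatingNumber (a ∘ b) A).ord ∧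
      dominatingNumber (a ∘ b) {i ∈ A | f b A x i < p i} < dominatingNumber (a ∘ b) A := by
    intro b A p
    by_cases h : A.Nonempty ∧ ∀ i, p i < a (b i)
    · obtain ⟨x, hx⟩ := (hf b A h.1).dominating p h.2
      exact ⟨x, fun _ _ => hx⟩
    · exact ⟨0, fun h1 h2 => (h ⟨h1, h2⟩).elim⟩
  choose bd hbd using hbd
  have hinv : ∀ β y, ∃ x, y < β → x < β.cof.ord ∧ y ≤ C β x := by
    intro β y
    by_cases h : y < β
    · obtain ⟨x, hx⟩ := hC β y h
      exact ⟨x, fun _ => hx⟩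
    · exact ⟨0, fun h' => (h h').elim⟩
  choose inv hinv using hinv
  let Θ := θ.ord.ToType
  have hΘ : #Θ = θ := Cardinal.mk_ord_toType _
  let K := ((ι → 𝔸) × Set ι × ι) ⊕ ((ι → 𝔸) × Set ι) ⊕ Θ ⊕ ULift.{u} (Fin 4)
  have hmul : ∀ {Y Z : Type u}, #Y ≤ θ → #Z ≤ θ → #(Y × Z) ≤ θ := fun hY hZ => by
    rw [Cardinal.mk_prod, Cardinal.lift_id, Cardinal.lift_id]
    exact (mul_le_mul' hY hZ).trans (Cardinal.mul_eq_self hθ).le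
  have hadd : ∀ {Y Z : Type u}, #Y ≤ θ → #Z ≤ θ → #(Y ⊕ Z) ≤ θ := fun hY hZ => by
    rw [Cardinal.mk_sum, Cardinal.lift_id, Cardinal.lift_id]
    exact (add_le_add hY hZ).trans (Cardinal.add_eq_self hθ).le
  have hK : #K ≤ θ := by
    refine hadd (hmul hB (hmul hset hcard)) (hadd (hmul hB hset) (hadd hΘ.le ?_))
    exact (Cardinal.lt_aleph0_of_finite _).le.trans hθ
  let op : K → (ι → Ordinal.{u}) → Ordinal.{u} := fun k p =>
    match k with
    | Sum.inl (b, A, i) => f b A (p i₀) i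
    | Sum.inr (Sum.inl (b, A)) => bd b A p
    | Sum.inr (Sum.inr (Sum.inl y)) => C (p i₀) (Ordinal.ToType.mk.symm y : Set.Iio θ.ord)
    | Sum.inr (Sum.inr (Sum.inr ⟨0⟩)) => 0
    | Sum.inr (Sum.inr (Sum.inr ⟨1⟩)) => ⨆ i, p i
    | Sum.inr (Sum.inr (Sum.inr ⟨2⟩)) => C (p i₀) (p i₁)
    | Sum.inr (Sum.inr (Sum.inr ⟨3⟩)) => inv (p i₀) (p i₁)
  obtain ⟨W, e, hW, hx, hcl⟩ := exists_range_closed_under (X := Option X) hθ hι hK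
    (by rw [Cardinal.mk_option]
        exact (add_le_add hX (Cardinal.one_le_aleph0.trans hθ)).trans (Cardinal.add_eq_self hθ).le)
    op (fun o => o.elim 0 x)
  have h0 : (0 : Ordinal.{u}) ∈ Set.range e := hx none
  let pr : Ordinal.{u} → Ordinal.{u} → ι → Ordinal.{u} := fun y z i => if i = i₀ then y else z
  have hpr : ∀ y ∈ Set.range e, ∀ z ∈ Set.range e, ∀ i, pr y z i ∈ Set.range e := by
    intro y hy z hz i
    dsimp only [pr]
    split_ifs
    exacts [hy, hz]
  have hp0 : ∀ y z, pr y z i₀ = y := fun y z => by simp [pr]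
  have hp1 : ∀ y z, pr y z i₁ = z := fun y z => by simp [pr, hi.symm]
  refine ⟨Set.range e, ⟨h0, ?_, ?_, ?_, ?_, ?_, ?_, ⟨W, e, hW, rfl⟩⟩, fun j => hx (some j)⟩
  · intro b A y hy i
    simpa [op, hp0] using hcl (Sum.inl (b, A, i)) _ (hpr y hy y hy)
  · intro b A p hA hp hpa
    exact ⟨bd b A p, hcl (Sum.inr (Sum.inl (b, A))) p hp, hbd b A p hA hpa⟩
  · intro p hp
    exact hcl (Sum.inr (Sum.inr (Sum.inr ⟨1⟩))) p hp
  · intro β hβ y hy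
    simpa [op, hp0] using hcl (Sum.inr (Sum.inr (Sum.inl (Ordinal.ToType.mk ⟨y, hy⟩)))) _
      (hpr β hβ β hβ)
  · intro β hβ y hy
    simpa [op, hp0, hp1] using hcl (Sum.inr (Sum.inr (Sum.inr ⟨2⟩))) _ (hpr β hβ y hy)
  · intro β hβ y hy hlt
    refine ⟨inv β y, ?_, hinv β y hlt⟩
    simpa [op, hp0, hp1] using hcl (Sum.inr (Sum.inr (Sum.inr ⟨3⟩))) _ (hpr β hβ y hy)

namespace IsClosedModel

variable {N N' : Set Ordinal.{u}}

/-- Choose p in N above the characteristic function of N' wherever that is possible. A scale term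
with index in N bounds p up to a small set, and a later term with index in N' has all its values in
N', so it lies below p at every offending coordinate. -/
theorem dominatingNumber_characteristic_lt (hθ : ℵ₀ ≤ θ) (ha : ∀ k, θ < (a k).cof)
    (hf : ∀ b A, A.Nonempty → IsScale (a ∘ b) A (f b A))
    (hN : IsClosedModel θ a f C N) (hN' : IsClosedModel θ a f C N') (b : ι → 𝔸) {A : Set ι}
    (hA : A.Nonempty)
    (h : characteristic N (dominatingNumber (a ∘ b) A).ord =
      characteristic N' (dominatingNumber (a ∘ b) A).ord) :
    dominatingNumber (a ∘ b) {i ∈ A | characteristic N' (a (b i)) < characteristic N (a (b i))} <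
      dominatingNumber (a ∘ b) A := by
  classical
  have hpos : ∀ k, 0 < a k := fun k => Ordinal.cof_pos.1 (bot_le.trans_lt (ha k))
  have hex : ∀ i, ∃ y ∈ N, y < a (b i) ∧
      (characteristic N' (a (b i)) < characteristic N (a (b i)) →
        characteristic N' (a (b i)) ≤ y) := by
    intro i
    by_cases hi : characteristic N' (a (b i)) < characteristic N (a (b i))
    · obtain ⟨y, h1, h2, h3⟩ := lt_characteristic.1 hi
      exact ⟨y, h1, h2, fun _ => h3⟩
    · exact ⟨0, hN.zero, hpos _, fun h => (hi h).elim⟩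
  choose p hpN hpa hp using hex
  obtain ⟨x, hxN, hx, hxp⟩ := hN.bound b A p hA hpN hpa
  obtain ⟨x', hx'N, hx', hxx'⟩ := lt_characteristic.1
    ((lt_characteristic.2 ⟨x, hxN, hx, le_rfl⟩).trans_eq h)
  refine (dominatingNumber_mono ?_).trans_lt (dominatingNumber_union_lt
    (hθ.trans (lt_dominatingNumber (fun i => ha (b i)) hA).le) hxp
    ((hf b A hA).increasing x x' hxx' hx'))
  rintro i ⟨hiA, hi⟩
  have h1 : f b A x' i < p i :=
    (lt_characteristic.2 ⟨_, hN'.scale b A x' hx'N i, (hf b A hA).lt x' hx' i, le_rfl⟩).trans_le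
      (hp i hi)
  by_cases h2 : f b A x i < p i
  · exact Or.inl ⟨hiA, h2⟩
  · exact Or.inr ⟨hiA, h1.trans_le (not_lt.1 h2)⟩

/-- Two closed models containing `β` with the same characteristic function at `cof β` share an
ordinal between any given element and `β`. -/
theorem exists_mem_inter [Infinite ι] (hι : #ι ≤ θ)
    (hC1 : ∀ o, ∀ x < o.cof.ord, C o x < o)
    (hC2 : ∀ o x y, x ≤ y → y < o.cof.ord → C o x ≤ C o y)
    (hN : IsClosedModel θ a f C N) (hN' : IsClosedModel θ a f C N') {β x : Ordinal.{u}}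
    (hβN : β ∈ N) (hβN' : β ∈ N') (hβ : θ < β.cof)
    (h : characteristic N β.cof.ord = characteristic N' β.cof.ord) (hx : x ∈ N) (hxβ : x < β) :
    ∃ s ∈ N, s ∈ N' ∧ x ≤ s ∧ s < β := by
  have key : ∀ {M M' : Set Ordinal.{u}}, IsClosedModel θ a f C M → IsClosedModel θ a f C M' →
      β ∈ M → β ∈ M' → characteristic M β.cof.ord = characteristic M' β.cof.ord →
      ∀ x ∈ M, x < β → ∃ y ∈ M', y < β ∧ x ≤ y := by
    intro M M' hM hM' hβM hβM' h x hx hxβ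
    obtain ⟨z, hzM, hz, hxz⟩ := hM.inv β hβM x hx hxβ
    obtain ⟨z', hz'M, hz', hzz'⟩ := lt_characteristic.1
      ((lt_characteristic.2 ⟨z, hzM, hz, le_rfl⟩).trans_eq h)
    exact ⟨C β z', hM'.map β hβM' z' hz'M, hC1 β z' hz', hxz.trans (hC2 β z z' hzz' hz')⟩
  -- Zigzag between the two models ω times. Both interleaved sequences have the same supremum, which
  -- lies in both models and below β because cof β > θ.
  choose up hup1 hup2 hup3 using key hN hN' hβN hβN' h
  choose dn hdn1 hdn2 hdn3 using key hN' hN hβN' hβN h.symm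
  let P := {y : Ordinal.{u} // y ∈ N ∧ y < β}
  let v : P → Ordinal.{u} := fun y => up y.1 y.2.1 y.2.2
  let st : P → P := fun y => ⟨dn (v y) (hup1 _ _ _) (hup2 _ _ _), hdn1 _ _ _, hdn2 _ _ _⟩
  let w : ℕ → P := fun n => st^[n] ⟨x, hx, hxβ⟩
  let r : ι → ℕ := Function.invFun (Infinite.natEmbedding ι)
  have hr : Function.Surjective r := Function.invFun_surjective (Infinite.natEmbedding ι).injective
  have hsup : ⨆ i, (w (r i)).1 = ⨆ i, v (w (r i)) := by
    apply le_antisymm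
    · rw [Ordinal.iSup_le_iff]
      intro i
      exact (hup3 _ _ _).trans (Ordinal.le_iSup (fun i => v (w (r i))) i)
    · rw [Ordinal.iSup_le_iff]
      intro i
      obtain ⟨j, hj⟩ := hr (r i + 1)
      have h1 : v (w (r i)) ≤ (w (r j)).1 := by
        rw [hj]
        have : w (r i + 1) = st (w (r i)) := Function.iterate_succ_apply' _ _ _
        rw [this]
        exact hdn3 _ _ _
      exact h1.trans (Ordinal.le_iSup (fun i => (w (r i)).1) j)
  refine ⟨⨆ i, (w (r i)).1, hN.iSup _ fun i => (w (r i)).2.1, ?_, ?_, ?_⟩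
  · rw [hsup]
    exact hN'.iSup _ fun i => hup1 _ _ _
  · obtain ⟨j, hj⟩ := hr 0
    have := Ordinal.le_iSup (fun i => (w (r i)).1) j
    rw [hj] at this
    exact this
  · exact Ordinal.iSup_lt_of_lt_cof (hι.trans_lt hβ) fun i => (w (r i)).2.2

end IsClosedModel

/-- The characteristic functions of closed models, restricted to `A`, are few. -/
theorem exists_characteristic_family (hθ : ℵ₀ ≤ θ) (hι : θ ^ #ι = θ) {ν : Cardinal.{u}}
    (hν : θ ≤ ν) (ha : ∀ k, θ < (a k).cof)
    (hf : ∀ b A, A.Nonempty → IsScale (a ∘ b) A (f b A)) (b : ι → 𝔸) (A : Set ι)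
    (hA : dominatingNumber (a ∘ b) A ≤ ν) :
    ∃ (T : Type u) (Φ : T → ι → Ordinal.{u}), #T ≤ ν ∧
      ∀ N, IsClosedModel θ a f C N → ∃ t, ∀ i ∈ A, characteristic N (a (b i)) = Φ t i := by
  classical
  have hset : #(Set ι) ≤ θ := by
    rw [Cardinal.mk_set, ← hι]
    exact Cardinal.power_le_power_right ((Cardinal.natCast_lt_aleph0 (n := 2)).le.trans hθ)
  induction hlam : dominatingNumber (a ∘ b) A using WellFoundedLT.induction generalizing A with
  | ind lam ih =>
  have hν0 := hθ.trans hν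
  rcases A.eq_empty_or_nonempty with rfl | hAne
  · exact ⟨PUnit, fun _ _ => 0, by simpa using Cardinal.one_le_aleph0.trans hν0,
      fun _ _ => ⟨⟨⟩, by simp⟩⟩
  let 𝒴 := {Y : Set ι // dominatingNumber (a ∘ b) Y < lam}
  choose T Φ hT hΦ using fun Y : 𝒴 => ih _ Y.2 Y.1 (Y.2.le.trans (hlam ▸ hA)) rfl
  have hrep : ∀ α : Ordinal.{u}, ∃ M : Set Ordinal.{u},
      (∃ N, IsClosedModel θ a f C N ∧ characteristic N lam.ord = α) →
      IsClosedModel θ a f C M ∧ characteristic M lam.ord = α := by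
    intro α
    by_cases h : ∃ N, IsClosedModel θ a f C N ∧ characteristic N lam.ord = α
    · exact ⟨h.choose, fun _ => h.choose_spec⟩
    · exact ⟨∅, fun h' => (h h').elim⟩
  choose M hM using hrep
  -- The successor is needed because the characteristic value at λ may equal λ. Each value gets a
  -- representative model M; another model with that value agrees with M off a set of smaller
  -- dominating number, which induction handles.
  let L := (Order.succ lam.ord).ToType
  let v : L → Ordinal.{u} := fun x => (Ordinal.ToType.mk.symm x : Set.Iio _)
  refine ⟨L × (Σ Y : 𝒴, T Y), fun t i => if i ∈ t.2.1.1 then Φ t.2.1 t.2.2 i else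
    characteristic (M (v t.1)) (a (b i)), ?_, fun N hN => ?_⟩
  · have h1 : #(Σ Y : 𝒴, T Y) ≤ ν := by
      rw [Cardinal.mk_sigma]
      calc (Cardinal.sum fun Y : 𝒴 => #(T Y)) ≤ Cardinal.sum fun _ : 𝒴 => ν :=
            Cardinal.sum_le_sum _ _ hT
        _ = #𝒴 * ν := by simp
        _ ≤ ν * ν := by
            gcongr
            exact (Cardinal.mk_subtype_le _).trans (hset.trans hν)
        _ = ν := Cardinal.mul_eq_self hν0
    have h2 : #L ≤ ν := by
      rw [Cardinal.mk_toType, Order.succ_eq_add_one, Ordinal.card_add_one, Cardinal.card_ord]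
      exact (add_le_add (hlam ▸ hA) (Cardinal.one_le_aleph0.trans hν0)).trans
        (Cardinal.add_eq_self hν0).le
    rw [Cardinal.mk_prod, Cardinal.lift_id, Cardinal.lift_id]
    exact (mul_le_mul' h2 h1).trans (Cardinal.mul_eq_self hν0).le
  · obtain ⟨hM1, hM2⟩ := hM (characteristic N lam.ord) ⟨N, hN, rfl⟩
    let l : L := Ordinal.ToType.mk ⟨characteristic N lam.ord,
      Order.lt_succ_of_le (characteristic_le _ _)⟩
    have hl : v l = characteristic N lam.ord := by simp [v, l]
    set M' := M (characteristic N lam.ord) with hM'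
    let Y : 𝒴 := ⟨{i ∈ A | characteristic M' (a (b i)) < characteristic N (a (b i))} ∪
      {i ∈ A | characteristic N (a (b i)) < characteristic M' (a (b i))}, by
        have hlam0 : ℵ₀ ≤ lam := by
          rw [← hlam]
          exact hθ.trans (lt_dominatingNumber (fun i => ha (b i)) hAne).le
        refine dominatingNumber_union_lt hlam0 ?_ ?_
        · exact (hN.dominatingNumber_characteristic_lt hθ ha hf hM1 b hAne
            (by rw [hlam, hM2])).trans_eq hlam
        · exact (hM1.dominatingNumber_characteristic_lt hθ ha hf hN b hAne
            (by rw [hlam, hM2])).trans_eq hlam⟩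
    obtain ⟨t, ht⟩ := hΦ Y N hN
    refine ⟨(l, ⟨Y, t⟩), fun i hi => ?_⟩
    dsimp only
    split_ifs with hiY
    · exact ht i hiY
    · rw [hl]
      by_contra hne
      rcases lt_or_gt_of_ne hne with h | h
      · exact hiY (Or.inr ⟨hi, h⟩)
      · exact hiY (Or.inl ⟨hi, h⟩)

end

/-! ### Counting functions through characteristic functions -/

/-- If all products of `#ι` many cofinalities of points `≤ Ω` are dominated by `ν` functions, then
there are at most `ν` functions from `ι` to `Ω`. -/
theorem mk_arrow_le_of_hasDominatingFamily {ι 𝔸 : Type u} [Infinite ι] [Nonempty 𝔸]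
    {θ ν : Cardinal.{u}} (hθ : ℵ₀ ≤ θ) (hι : θ ^ #ι = θ) (h𝔸 : #𝔸 ≤ θ) (hν : θ ≤ ν)
    (a : 𝔸 → Ordinal.{u}) (ha : ∀ k, θ < (a k).cof) (Ω : Ordinal.{u})
    (hΩ : ∀ x ≤ Ω, θ < x.cof → ∃ k, a k = x.cof.ord)
    (hdom : ∀ b : ι → 𝔸, HasDominatingFamily (a ∘ b) Set.univ ν) : #(ι → Ω.ToType) ≤ ν := by
  classical
  have hset : #(Set ι) ≤ θ := by
    rw [Cardinal.mk_set, ← hι]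
    exact Cardinal.power_le_power_right ((Cardinal.natCast_lt_aleph0 (n := 2)).le.trans hθ)
  have hcard : #ι ≤ θ := (Cardinal.cantor #ι).le.trans (by rwa [← Cardinal.mk_set])
  have hB : #(ι → 𝔸) ≤ θ := by
    rw [← Cardinal.power_def, ← hι]
    exact Cardinal.power_le_power_right h𝔸
  have hν0 := hθ.trans hν
  have hscale : ∀ (b : ι → 𝔸) (A : Set ι), ∃ f, A.Nonempty → IsScale (a ∘ b) A f := by
    intro b A
    by_cases hA : A.Nonempty
    · obtain ⟨f, hf⟩ := exists_isScale hθ hι (a ∘ b) (fun i => ha (b i)) hA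
      exact ⟨f, fun _ => hf⟩
    · exact ⟨0, fun h => (hA h).elim⟩
  choose f hf using hscale
  choose C hC1 hC2 hC3 using exists_cofinal_map.{u}
  have hC2' : ∀ o x y, x ≤ y → y < o.cof.ord → C o x ≤ C o y := by
    intro o x y hxy hy
    rcases hxy.eq_or_lt with rfl | hxy
    exacts [le_rfl, (hC2 o x y hxy hy).le]
  let Θ := θ.ord.ToType
  have hΘ : #Θ = θ := Cardinal.mk_ord_toType _
  let v : Θ → Ordinal.{u} := fun x => (Ordinal.ToType.mk.symm x : Set.Iio θ.ord)
  have hv : ∀ x < θ.ord, ∃ y : Θ, v y = x := fun x hx => ⟨Ordinal.ToType.mk ⟨x, hx⟩, by simp [v]⟩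
  have henum : ∀ W : Type u, ∀ e : W → Ordinal.{u}, #W ≤ θ →
      ∃ E : Θ → Ordinal.{u}, Set.range e ⊆ Set.range E := by
    intro W e hW
    rcases isEmpty_or_nonempty W with hW' | hW'
    · exact ⟨0, by rw [Set.range_eq_empty]; exact Set.empty_subset _⟩
    · have : Nonempty (W ↪ Θ) := by rwa [← Cardinal.le_def, hΘ]
      obtain ⟨j⟩ := this
      refine ⟨e ∘ Function.invFun j, ?_⟩
      rw [(Function.invFun_surjective j.injective).range_comp]
  have hE : ∀ β c : Ordinal.{u}, ∃ E : Θ → Ordinal.{u},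
      (∃ N, IsClosedModel θ a f C N ∧ β ∈ N ∧ characteristic N β.cof.ord = c) →
      ∃ N, IsClosedModel θ a f C N ∧ β ∈ N ∧ characteristic N β.cof.ord = c ∧
        N ⊆ Set.range E := by
    intro β c
    by_cases h : ∃ N, IsClosedModel θ a f C N ∧ β ∈ N ∧ characteristic N β.cof.ord = c
    · obtain ⟨N, hN, h1, h2⟩ := h
      obtain ⟨W, e, hW, rfl⟩ := hN.card
      obtain ⟨E, hE⟩ := henum W e hW
      exact ⟨E, fun _ => ⟨_, hN, h1, h2, hE⟩⟩
    · exact ⟨0, fun h' => (h h').elim⟩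
  choose E hE using hE
  -- R c enumerates at most θ ordinals reachable from Ω knowing only the values c. Every c i is
  -- tried at every β, so no record is needed of which index belongs to cof β.
  have hR : ∀ c : ι → Ordinal.{u}, ∃ R : Θ → Ordinal.{u}, Ω ∈ Set.range R ∧
      (∀ β ∈ Set.range R, ∀ y, C β (v y) ∈ Set.range R) ∧
      ∀ β ∈ Set.range R, ∀ i y, E β (c i) y ∈ Set.range R := by
    intro c
    obtain ⟨i₀⟩ : Nonempty ι := inferInstance
    have hK : #(Θ ⊕ ι × Θ) ≤ θ := by
      rw [Cardinal.mk_sum, Cardinal.lift_id, Cardinal.lift_id, Cardinal.mk_prod, Cardinal.lift_id,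
        Cardinal.lift_id, hΘ]
      exact (add_le_add le_rfl ((mul_le_mul' hcard le_rfl).trans
        (Cardinal.mul_eq_self hθ).le)).trans (Cardinal.add_eq_self hθ).le
    obtain ⟨W, e, hW, hx, hcl⟩ := exists_range_closed_under (X := PUnit) hθ hι hK
      (by simpa using Cardinal.one_le_aleph0.trans hθ)
      (fun k p => k.elim (fun y => C (p i₀) (v y)) (fun s => E (p i₀) (c s.1) s.2)) (fun _ => Ω)
    have : Nonempty W := (hx ⟨⟩).nonempty
    have : Nonempty (W ↪ Θ) := by rwa [← Cardinal.le_def, hΘ]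
    obtain ⟨j⟩ := this
    have hrange : Set.range (e ∘ Function.invFun j) = Set.range e :=
      (Function.invFun_surjective j.injective).range_comp e
    refine ⟨e ∘ Function.invFun j, ?_⟩
    rw [hrange]
    exact ⟨hx ⟨⟩, fun β hβ y => hcl (Sum.inl y) (fun _ => β) fun _ => hβ,
      fun β hβ i y => hcl (Sum.inr (i, y)) (fun _ => β) fun _ => hβ⟩
  choose R hRΩ hRC hRE using hR
  -- Descend from β to x inside N. If cof β ≤ θ, step along C β; otherwise step to a common element
  -- of N and the representative model chosen for β and the value at cof β. Well-foundedness makes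
  -- the list of values used finite.
  have hwalk : ∀ N, IsClosedModel θ a f C N → ∀ x ∈ N, ∀ β, β ∈ N → β ≤ Ω → x ≤ β →
      ∀ s : List 𝔸,
      (∀ c : ι → Ordinal.{u}, (∀ k ∈ s, ∃ i, c i = characteristic N (a k)) →
        β ∈ Set.range (R c)) →
      ∃ s : List 𝔸, ∀ c : ι → Ordinal.{u}, (∀ k ∈ s, ∃ i, c i = characteristic N (a k)) →
        x ∈ Set.range (R c) := by
    intro N hN x hx β
    induction β using WellFoundedLT.induction with
    | ind β ih =>
    intro hβN hβΩ hxβ s hs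
    rcases hxβ.eq_or_lt with rfl | hlt
    · exact ⟨s, hs⟩
    rcases le_or_gt β.cof θ with hcof | hcof
    · obtain ⟨z, hz, hxz⟩ := hC3 β x hlt
      have hzθ : z < θ.ord := hz.trans_le (Cardinal.ord_le_ord.2 hcof)
      refine ih (C β z) (hC1 β z hz) (hN.small β hβN z hzθ) ((hC1 β z hz).le.trans hβΩ) hxz s
        fun c hc => ?_
      obtain ⟨y, rfl⟩ := hv z hzθ
      exact hRC c β (hs c hc) y
    · obtain ⟨k, hk⟩ := hΩ β hβΩ hcof
      obtain ⟨N', hN', h1, h2, h3⟩ := hE β _ ⟨N, hN, hβN, rfl⟩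
      obtain ⟨z, hzN, hzN', hxz, hzβ⟩ := hN.exists_mem_inter hcard hC1 hC2' hN' hβN h1 hcof h2.symm
        hx hlt
      refine ih z hzβ hzN (hzβ.le.trans hβΩ) hxz (k :: s) fun c hc => ?_
      obtain ⟨i, hi⟩ := hc k List.mem_cons_self
      obtain ⟨y, rfl⟩ := h3 hzN'
      rw [← hk, ← hi]
      exact hRE c β (hs c fun k' hk' => hc k' (List.mem_cons_of_mem _ hk')) i y
  have hΦ : ∀ b : ι → 𝔸, ∃ (T : Type u) (Φ : T → ι → Ordinal.{u}), #T ≤ ν ∧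
      ∀ N, IsClosedModel θ a f C N → ∃ t, ∀ i, characteristic N (a (b i)) = Φ t i := by
    intro b
    obtain ⟨T, Φ, hT, h⟩ := exists_characteristic_family (C := C) hθ hι hν ha hf b Set.univ
      (dominatingNumber_le (hdom b))
    exact ⟨T, Φ, hT, fun N hN => (h N hN).imp fun t ht i => ht i (Set.mem_univ i)⟩
  choose T Φ hT hΦ using hΦ
  have hcode : ∀ g : ι → Ω.ToType, ∃ (b : ι → 𝔸) (t : T b) (y : ι → Θ), ∀ i,
      ((Ordinal.ToType.mk.symm (g i) : Set.Iio Ω) : Ordinal.{u}) = R (Φ b t) (y i) := by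
    intro g
    obtain ⟨N, hN, hgN⟩ := exists_isClosedModel (C := C) hθ hι h𝔸 hf hC3 (X := Option ι)
      (by rw [Cardinal.mk_option]
          exact (add_le_add hcard (Cardinal.one_le_aleph0.trans hθ)).trans
            (Cardinal.add_eq_self hθ).le)
      (fun o => o.elim Ω fun i => (Ordinal.ToType.mk.symm (g i) : Set.Iio Ω))
    have hs := fun i => hwalk N hN _ (hgN (some i)) Ω (hgN none) le_rfl
      (le_of_lt (Ordinal.ToType.mk.symm (g i)).2) [] fun c _ => hRΩ c
    choose s hs using hs
    -- The finite lists for all coordinates of g fit into a single ι-sequence b, with k₀ as padding.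
    have hσ : Nonempty (ι ≃ ι × ℕ) := by
      rw [← Cardinal.eq]
      simp
    obtain ⟨σ⟩ := hσ
    obtain ⟨k₀⟩ : Nonempty 𝔸 := inferInstance
    let b : ι → 𝔸 := fun j => (s (σ j).1).getD (σ j).2 k₀
    obtain ⟨t, ht⟩ := hΦ b N hN
    have hmem : ∀ i, ((Ordinal.ToType.mk.symm (g i) : Set.Iio Ω) : Ordinal.{u}) ∈
        Set.range (R (Φ b t)) := by
      intro i
      refine hs i _ fun k hk => ?_
      obtain ⟨n, hn, rfl⟩ := List.getElem_of_mem hk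
      refine ⟨σ.symm (i, n), ?_⟩
      rw [← ht]
      simp [b, hn]
    choose y hy using hmem
    exact ⟨b, t, y, fun i => (hy i).symm⟩
  choose b t y hy using hcode
  let code : (ι → Ω.ToType) → (Σ b, T b) × (ι → Θ) := fun g => (⟨b g, t g⟩, y g)
  have hinj : Function.Injective code := by
    intro g g' h
    have hR' : ∀ p q : (Σ b, T b) × (ι → Θ), p = q →
        ∀ i, R (Φ p.1.1 p.1.2) (p.2 i) = R (Φ q.1.1 q.1.2) (q.2 i) := by
      rintro p _ rfl i
      rfl
    funext i
    have h1 := hR' _ _ h i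
    rw [← hy, ← hy] at h1
    exact Ordinal.ToType.mk.symm.injective (Subtype.ext h1)
  refine (Cardinal.mk_le_of_injective hinj).trans ?_
  have h1 : #(Σ b, T b) ≤ ν := by
    rw [Cardinal.mk_sigma]
    calc (Cardinal.sum fun b => #(T b)) ≤ Cardinal.sum fun _ : ι → 𝔸 => ν :=
          Cardinal.sum_le_sum _ _ hT
      _ = #(ι → 𝔸) * ν := by rw [Cardinal.sum_const']
      _ ≤ ν * ν := by
          gcongr
          exact hB.trans hν
      _ = ν := Cardinal.mul_eq_self hν0
  have h2 : #(ι → Θ) ≤ ν := by rwa [← Cardinal.power_def, hΘ, hι]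
  rw [Cardinal.mk_prod, Cardinal.lift_id, Cardinal.lift_id]
  exact (mul_le_mul' h1 h2).trans (Cardinal.mul_eq_self hν0).le

/-! ### Bounding the index -/

/-- If `θ ^ κ = θ < ℵ_ δ` and `δ` has size at most `θ`, then the index of `ℵ_ δ ^ κ` has size at
most `θ`. -/
theorem card_index_le_of_power_eq {θ κ : Cardinal.{u}} (hκ : ℵ₀ ≤ κ) (hθ : ℵ₀ ≤ θ)
    (hθκ : θ ^ κ = θ) {δ γ : Ordinal.{u}} (hδ : δ.card ≤ θ) (hθδ : θ < ℵ_ δ)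
    (hγ : (ℵ_ δ) ^ κ = ℵ_ γ) : γ.card ≤ θ := by
  classical
  let ι := κ.ord.ToType
  have hικ : #ι = κ := Cardinal.mk_ord_toType κ
  have hι : θ ^ #ι = θ := by rw [hικ, hθκ]
  have : Infinite ι := Cardinal.infinite_iff.2 (by rwa [hικ])
  have hset : #(Set ι) ≤ θ := by
    rw [Cardinal.mk_set, ← hι]
    exact Cardinal.power_le_power_right ((Cardinal.natCast_lt_aleph0 (n := 2)).le.trans hθ)
  -- The index δ itself is allowed, since points up to and including ω_δ must be covered.
  let D := (Order.succ δ).ToType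
  let w : D → Ordinal.{u} := fun x => (Ordinal.ToType.mk.symm x : Set.Iio _)
  have hw : ∀ x ≤ δ, ∃ y : D, w y = x := fun x hx =>
    ⟨Ordinal.ToType.mk ⟨x, Order.lt_succ_of_le hx⟩, by simp [w]⟩
  let 𝔸 := {k : D // θ < (ω_ (w k)).cof}
  let a : 𝔸 → Ordinal.{u} := fun k => ω_ (w k.1)
  have hD : #D ≤ θ := by
    rw [Cardinal.mk_toType, Order.succ_eq_add_one, Ordinal.card_add_one]
    exact (add_le_add hδ (Cardinal.one_le_aleph0.trans hθ)).trans (Cardinal.add_eq_self hθ).le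
  have h𝔸 : #𝔸 ≤ θ := (Cardinal.mk_subtype_le _).trans hD
  have hΩ : ∀ x ≤ ω_ δ, θ < x.cof → ∃ k, a k = x.cof.ord := by
    intro x hx hxθ
    obtain ⟨ε, hε⟩ := Cardinal.mem_range_aleph_iff.2 (hθ.trans hxθ.le)
    have hord : x.cof.ord = ω_ ε := by rw [← hε, Cardinal.ord_aleph]
    have hεδ : ε ≤ δ := by
      rw [← Ordinal.omega_le_omega, ← hord]
      exact (Ordinal.ord_cof_le x).trans hx
    obtain ⟨y, rfl⟩ := hw ε hεδ
    exact ⟨⟨y, by rw [← hord, Ordinal.cof_ord_cof]; exact hxθ⟩, hord.symm⟩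
  have hne : Nonempty 𝔸 := by
    -- θ⁺ is regular and at most ℵ_δ.
    have h1 := (Cardinal.isRegular_succ hθ).cof_ord
    obtain ⟨k, -⟩ := hΩ (Order.succ θ).ord
      (by rw [← Cardinal.ord_aleph]; exact Cardinal.ord_le_ord.2 (Order.succ_le_of_lt hθδ))
      (by rw [h1]; exact Order.lt_succ θ)
    exact ⟨k⟩
  have hB : #(ι → 𝔸) ≤ θ := by
    rw [← Cardinal.power_def, ← hι]
    exact Cardinal.power_le_power_right h𝔸
  have key : ∀ ε, δ ≤ ε → ε < γ → ∃ (b : ι → 𝔸) (A : Set ι),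
      dominatingNumber (a ∘ b) A = Order.succ (ℵ_ ε) := by
    intro ε hδε hεγ
    have hν : θ ≤ ℵ_ ε := hθδ.le.trans (Cardinal.aleph_le_aleph.2 hδε)
    obtain ⟨b, hb⟩ : ∃ b : ι → 𝔸, ¬ HasDominatingFamily (a ∘ b) Set.univ (ℵ_ ε) := by
      by_contra! hdom
      have h1 := mk_arrow_le_of_hasDominatingFamily hθ hι h𝔸 hν a (fun k => k.2) (ω_ δ) hΩ hdom
      rw [← Cardinal.power_def, Cardinal.mk_toType, Ordinal.card_omega, hικ, hγ,
        Cardinal.aleph_le_aleph] at h1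
      exact absurd hεγ (not_lt.2 h1)
    obtain ⟨g, A, hgb, hg, hA⟩ := exists_dominatingNumber_eq_succ hθ hι hν (a ∘ b)
      (fun i => (b i).2) hb
    have hga : ∀ i, ∃ k, a k = (g i).cof.ord := by
      intro i
      refine hΩ (g i) ((hgb i).trans ?_) (hg i)
      exact Ordinal.omega_le_omega.2
        (Order.lt_succ_iff.1 (Ordinal.ToType.mk.symm (b i).1).2)
    choose b' hb' using hga
    refine ⟨b', A, ?_⟩
    -- Passing to cofinalities brings the arbitrary ordinals g i back into the small set of values
    -- of a.
    rw [← hA, ← dominatingNumber_cof (fun i => hθ.trans (hg i).le)]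
    congr 1
    exact funext hb'
  choose b A hbA using key
  let Γ := γ.ToType
  let v : Γ → Ordinal.{u} := fun x => (Ordinal.ToType.mk.symm x : Set.Iio γ)
  have hvinj : Function.Injective v := fun x y h =>
    Ordinal.ToType.mk.symm.injective (Subtype.ext h)
  have hvγ : ∀ x, v x < γ := fun x => (Ordinal.ToType.mk.symm x).2
  -- An index below δ codes itself; any other index is recovered from its pair through the
  -- dominating number.
  let code : Γ → D ⊕ (ι → 𝔸) × Set ι := fun x =>
    if h : δ ≤ v x then Sum.inr (b (v x) h (hvγ x), A (v x) h (hvγ x))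
    else Sum.inl (Ordinal.ToType.mk ⟨v x, Order.lt_succ_of_le (not_le.1 h).le⟩)
  have hinj : Function.Injective code := by
    intro x y hxy
    dsimp only [code] at hxy
    apply hvinj
    split_ifs at hxy with h1 h2
    · have h3 := hbA (v x) h1 (hvγ x)
      have h4 := hbA (v y) h2 (hvγ y)
      rw [Sum.inr.injEq, Prod.mk.injEq] at hxy
      rw [hxy.1, hxy.2, h4, Cardinal.succ_aleph, Cardinal.succ_aleph] at h3
      have h5 := Cardinal.aleph.injective h3
      exact (Order.succ_injective (by simpa [Order.succ_eq_add_one] using h5)).symm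
    · rw [Sum.inl.injEq] at hxy
      exact Subtype.mk.inj (OrderIso.injective (Ordinal.ToType.mk (o := Order.succ δ)) hxy)
  have hle := Cardinal.mk_le_of_injective hinj
  rw [Cardinal.mk_toType] at hle
  refine hle.trans ?_
  rw [Cardinal.mk_sum, Cardinal.lift_id, Cardinal.lift_id, Cardinal.mk_prod, Cardinal.lift_id,
    Cardinal.lift_id]
  exact (add_le_add hD ((mul_le_mul' hB hset).trans (Cardinal.mul_eq_self hθ).le)).trans
    (Cardinal.add_eq_self hθ).le

/-- The index of `ℵ_ δ ^ cof δ` is below `(|δ| ^ cof δ)⁺`. -/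
theorem exists_aleph_power_cof_eq (δ : Ordinal.{u}) (hδ : Order.IsSuccLimit δ) :
    ∃ γ : Ordinal.{u}, (ℵ_ δ) ^ δ.cof = ℵ_ γ ∧ γ < (Order.succ (δ.card ^ δ.cof)).ord := by
  have hκ : ℵ₀ ≤ δ.cof := Ordinal.aleph0_le_cof_iff.2 (Ordinal.one_lt_cof_iff.2 hδ)
  have hκ0 : δ.cof ≠ 0 := (Cardinal.aleph0_pos.trans_le hκ).ne'
  have hcard : ℵ₀ ≤ δ.card := hκ.trans (Ordinal.cof_le_card δ)
  have hδθ : δ.card ≤ δ.card ^ δ.cof := Cardinal.self_le_power _ (Cardinal.one_le_aleph0.trans hκ)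
  have hθκ : (δ.card ^ δ.cof) ^ δ.cof = δ.card ^ δ.cof := by
    rw [← Cardinal.power_mul, Cardinal.mul_eq_self hκ]
  obtain ⟨γ, hγ⟩ := Cardinal.mem_range_aleph_iff.2 ((Cardinal.aleph0_le_aleph δ).trans
    (Cardinal.self_le_power (ℵ_ δ) (Cardinal.one_le_aleph0.trans hκ)))
  refine ⟨γ, hγ.symm, Cardinal.lt_ord.2 (Order.lt_succ_of_le ?_)⟩
  rcases le_or_gt (ℵ_ δ) (δ.card ^ δ.cof) with h | h
  · refine (Ordinal.card_le_aleph γ).trans ?_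
    rw [hγ, ← hθκ]
    exact Cardinal.power_le_power_right h
  · exact card_index_le_of_power_eq hκ (hcard.trans hδθ) hθκ hδθ h hγ.symm

theorem mainTheorem12 :
    ((2 : Cardinal.{u}) ^ (ℵ₀ : Cardinal.{u}) < ℵ_ (Ordinal.omega0.{u}) →
      (ℵ_ (Ordinal.omega0.{u})) ^ (ℵ₀ : Cardinal.{u}) <
        ℵ_ ((Order.succ ((2 : Cardinal.{u}) ^ (ℵ₀ : Cardinal.{u}))).ord)) ∧
    -- the general bound: the index `γ` of `ℵ_δ ^ cof δ` is below `(|δ| ^ cof δ)⁺`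
    (∀ δ : Ordinal.{u}, Order.IsSuccLimit δ →
      ∃ γ : Ordinal.{u}, (ℵ_ δ) ^ δ.cof = ℵ_ γ ∧
        γ < (Order.succ (δ.card ^ δ.cof)).ord) := by
  refine ⟨fun _ => ?_, exists_aleph_power_cof_eq⟩
  obtain ⟨γ, hγ, hlt⟩ := exists_aleph_power_cof_eq.{u} Ordinal.omega0 Ordinal.isSuccLimit_omega0
  rw [Ordinal.cof_omega0] at hγ
  rw [Ordinal.cof_omega0, Ordinal.card_omega0, Cardinal.power_self_eq le_rfl] at hlt
  rw [hγ]
  exact Cardinal.aleph_lt_aleph.2 hlt
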